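/- Let $G$ be a locally compact (Hausdorff) second countable group, $\Gamma<G$ a uniform lattice (a discrete subgroup with $G/\Gamma$ compact), and $X$ a complete separable CAT(0) space with a $\Gamma$-action by isometries. Let $\mathscr F\subseteq G$ be a relatively compact Borel fundamental domain for the action of $\Gamma$ on $G$ by right multiplication such that $\{\eta\in\Gamma:\mathscr F\eta\cap C\neq\varnothing\}$ is finite for every compact $C\subseteq G$, and let $dg$ be the Haar measure on $G$ normalized so that $\mathscr F$ has measure $1$. Let $L^{[2]}(G,X)^\Gamma$ be the space of measurable maps $f:G\to X$ with separable range, modulo null sets, such that $f(g\gamma^{-1})=\gamma f(g)$ for all $g\in G$, $\gamma\in\Gamma$, and such that $g\mapsto d(f(g),x)$ is in $L^2(\mathscr F)$ for some (hence any) $x\in X$; endow it with the metric $$d(f,f')=\Big(\int_{\mathscr F} d^2(f(g),f'(g))\,dg\Big)^{1/2}$$ and with the $G$-action $(hf)(g)=f(h^{-1}g)$. An action of a topological group $H$ by isometries on a metric space $Y$ is called evanescent if there is an unbounded set $T\subseteq Y$ such that for every compact set $Q\subseteq H$ the set $\{d(hy,y):h\in Q,\ y\in T\}$ is bounded. If the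 $G$-action on $L^{[2]}(G,X)^\Gamma$ is evanescent, then the $\Gamma$-action on $X$ is evanescent. -/

import Mathlib

open MeasureTheory Set
open scoped ENNReal Pointwise

/-! ### CAT(0) spaces -/

/-- `σ`, restricted to `[0, dist x y]`, is a geodesic segment from `x` to `y`. -/
structure IsGeodesicSegment {X : Type*} [MetricSpace X] (σ : ℝ → X) (x y : X) : Prop where
  source : σ 0 = x
  target : σ (dist x y) = y
  isometric : ∀ s ∈ Icc 0 (dist x y), ∀ t ∈ Icc 0 (dist x y), dist (σ s) (σ t) = |s - t|

/-- A CAT(0) space: a geodesic metric space in which the midpoint of every geodesic segment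
satisfies the Bruhat-Tits inequality. -/
class IsCAT0 (X : Type*) [MetricSpace X] : Prop where
  exists_geodesic : ∀ x y : X, ∃ σ : ℝ → X, IsGeodesicSegment σ x y
  bruhat_tits : ∀ (x c c' : X) (σ : ℝ → X), IsGeodesicSegment σ c c' →
    2 * dist (σ (dist c c' / 2)) x ^ 2 ≤
      dist c' x ^ 2 + dist c x ^ 2 - 1 / 2 * dist c' c ^ 2

/-! ### Evanescent actions -/

/-- A subset `T` of a `G`-space is `Q`-evanescent if the displacements of its points by elements
of `Q` are bounded. -/
def IsEvanescentSet {G Y : Type*} [SMul G Y] [MetricSpace Y] (Q : Set G) (T : Set Y) : Prop :=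
  ∃ K : ℝ, ∀ g ∈ Q, ∀ x ∈ T, dist (g • x) x ≤ K

/-- The action of the topological group `G` on `Y` is evanescent: some unbounded set is
`Q`-evanescent for every compact `Q ⊆ G`. -/
def IsEvanescent (G Y : Type*) [Group G] [TopologicalSpace G] [MulAction G Y] [MetricSpace Y] :
    Prop :=
  ∃ T : Set Y, ¬ Bornology.IsBounded T ∧ ∀ Q : Set G, IsCompact Q → IsEvanescentSet Q T

/-! ### The induced space -/

section Induction

variable {G : Type*} [Group G] [TopologicalSpace G] [MeasurableSpace G]

/-- Relatively compact Borel fundamental domains `F` for the action of `Γ` on `G` by right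
multiplication such that only finitely many translates `F η` meet a given compact set, with
respect to a measure `μ` for which `F` has mass one. -/
structure RightFundamentalDomain (Γ : Subgroup G) (μ : Measure G) where
  carrier : Set G
  measurableSet : MeasurableSet carrier
  isFundamentalDomain : IsFundamentalDomain Γ.op carrier μ
  isCompact_closure : IsCompact (closure carrier)
  finite_meet : ∀ C : Set G, IsCompact C →
    {η : Γ | (((fun g : G => g * (η : G)) '' carrier) ∩ C).Nonempty}.Finite
  measure_eq_one : μ carrier = 1

set_option maxHeartbeats 1000000 in
/-- Normalized fundamental domains exist for every discrete cocompact subgroup. -/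
theorem RightFundamentalDomain.exists_haar [IsTopologicalGroup G] [T2Space G]
    [LocallyCompactSpace G] [SecondCountableTopology G] [BorelSpace G]
    (Γ : Subgroup G) [DiscreteTopology Γ] [CompactSpace (G ⧸ Γ)] :
    ∃ μ : Measure G, μ.IsHaarMeasure ∧ Nonempty (RightFundamentalDomain Γ μ) := by
  have : Countable Γ := TopologicalSpace.separableSpace_iff_countable.1 inferInstance
  have hclosed : IsClosed (Γ : Set G) := Γ.isClosed_of_discrete
  -- an open relatively compact `V` that embeds into the quotient
  obtain ⟨W, hW, hWΓ⟩ : ∃ W : Set G, IsOpen W ∧ W ∩ Γ = {1} := by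
    obtain ⟨W, hW, hW'⟩ := isOpen_induced_iff.1 (isOpen_discrete ({1} : Set Γ))
    refine ⟨W, hW, Set.ext fun g => ⟨fun hg => ?_, ?_⟩⟩
    · have : (⟨g, hg.2⟩ : Γ) ∈ ((↑) : Γ → G) ⁻¹' W := hg.1
      rw [hW'] at this
      exact congrArg Subtype.val this
    · rintro rfl
      have : (1 : Γ) ∈ ((↑) : Γ → G) ⁻¹' W := by rw [hW']; rfl
      exact ⟨this, Γ.one_mem⟩
  have h1W : (1 : G) ∈ W := (hWΓ.symm ▸ mem_singleton (1 : G) : (1 : G) ∈ W ∩ Γ).1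
  obtain ⟨V₀, hV₀, hV₀W⟩ : ∃ V ∈ nhds (1 : G), ∀ v ∈ V, ∀ w ∈ V, v⁻¹ * w ∈ W := by
    have hc : Filter.Tendsto (fun p : G × G => p.1⁻¹ * p.2) (nhds 1 ×ˢ nhds 1) (nhds 1) := by
      have : Continuous fun p : G × G => p.1⁻¹ * p.2 := by fun_prop
      simpa [nhds_prod_eq] using this.tendsto (1, 1)
    obtain ⟨V, hV, hVW⟩ := Filter.mem_prod_same_iff.1 (hc (hW.mem_nhds h1W))
    exact ⟨V, hV, fun v hv w hw => hVW (Set.mk_mem_prod hv hw)⟩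
  obtain ⟨K, hK, hK1⟩ := exists_compact_mem_nhds (1 : G)
  set V := interior (V₀ ∩ K) with hVdef
  have hVo : IsOpen V := isOpen_interior
  have hV1 : (1 : G) ∈ V := mem_interior_iff_mem_nhds.2 (Filter.inter_mem hV₀ hK1)
  have hVΓ : ∀ g v w : G, v ∈ g • V → w ∈ g • V → v⁻¹ * w ∈ Γ → v = w := by
    rintro g _ _ ⟨v, hv, rfl⟩ ⟨w, hw, rfl⟩ hmem
    have h2 : v⁻¹ * w ∈ W :=
      hV₀W v (interior_subset hv).1 w (interior_subset hw).1
    have h3 : v⁻¹ * w ∈ W ∩ Γ := ⟨h2, by simpa [mul_assoc] using hmem⟩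
    rw [hWΓ] at h3
    rw [inv_mul_eq_one.1 h3]
  -- finitely many translates of `V` cover the quotient
  let U : G → Set (G ⧸ Γ) := fun g => ((↑) : G → G ⧸ Γ) '' (g • V)
  have hUo : ∀ g, IsOpen (U g) := fun g => QuotientGroup.isOpenMap_coe _ (hVo.smul g)
  obtain ⟨t, ht⟩ := isCompact_univ.elim_finite_subcover U hUo (fun q _ => by
    induction q using QuotientGroup.induction_on with
    | H g => exact mem_iUnion.2 ⟨g, g, ⟨1, hV1, by simp⟩, rfl⟩)
  let e := t.equivFin
  let a : Fin t.card → G := fun i => (e.symm i : G)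
  let F : Set G := ⋃ i, (a i • V ∩ ⋂ j, ⋂ _ : j < i, {x | (x : G ⧸ Γ) ∉ U (a j)})
  have hFm : MeasurableSet F := by
    refine MeasurableSet.iUnion fun i => (hVo.smul _).measurableSet.inter ?_
    refine MeasurableSet.iInter fun j => MeasurableSet.iInter fun _ => ?_
    exact ((hUo _).preimage QuotientGroup.continuous_mk).measurableSet.compl
  have hFc : IsCompact (closure F) := by
    have hc : IsCompact (⋃ i, a i • K) := isCompact_iUnion fun i => hK.smul _
    refine hc.of_isClosed_subset isClosed_closure (closure_minimal ?_ hc.isClosed)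
    exact iUnion_mono fun i => inter_subset_left.trans
      (smul_set_mono (interior_subset.trans inter_subset_right))
  have hF : ∀ x : G, ∃! γ : Γ.op, γ • x ∈ F := by
    intro x
    have hmk : ∀ γ : Γ.op, ((γ • x : G) : G ⧸ Γ) = (x : G ⧸ Γ) := by
      rintro ⟨γ, hγ⟩
      exact QuotientGroup.mk_mul_of_mem x hγ
    have hex : ∃ i, (x : G ⧸ Γ) ∈ U (a i) := by
      obtain ⟨g, hg, hx⟩ := mem_iUnion₂.1 (ht (mem_univ (x : G ⧸ Γ)))
      exact ⟨e ⟨g, hg⟩, by simpa [a] using hx⟩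
    classical
    obtain ⟨i, hi, hmin⟩ := WellFounded.has_min (wellFounded_lt (α := Fin t.card))
      {i | (x : G ⧸ Γ) ∈ U (a i)} hex
    obtain ⟨v, hv, hvx⟩ := hi
    have hmem : x⁻¹ * v ∈ Γ := QuotientGroup.eq.1 hvx.symm
    refine ⟨⟨MulOpposite.op (x⁻¹ * v), hmem⟩, ?_, ?_⟩
    · have hxv : ((⟨MulOpposite.op (x⁻¹ * v), hmem⟩ : Γ.op) • x : G) = v := by
        change x * (x⁻¹ * v) = v
        simp
      refine mem_iUnion.2 ⟨i, by rw [hxv]; exact hv, ?_⟩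
      refine mem_iInter₂.2 fun j hj => ?_
      change ((_ : G) : G ⧸ Γ) ∉ U (a j)
      rw [hmk]
      exact fun hx => hmin j hx hj
    · rintro ⟨γ, hγ⟩ hγF
      obtain ⟨k, hk, hk'⟩ := mem_iUnion.1 hγF
      have hxk : (x : G ⧸ Γ) ∈ U (a k) := ⟨_, hk, hmk _⟩
      have hki : k = i := by
        refine le_antisymm (not_lt.1 fun hlt => ?_) (not_lt.1 fun hlt => hmin k hxk hlt)
        have := mem_iInter₂.1 hk' i hlt
        change ((_ : G) : G ⧸ Γ) ∉ U (a i) at this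
        rw [hmk] at this
        exact this ⟨v, hv, hvx⟩
      subst hki
      have hk2 : x * γ.unop ∈ a k • V := hk
      have hγ' : γ.unop ∈ Γ := hγ
      have := hVΓ _ _ _ hk2 hv (by
        have := Γ.mul_mem (Γ.inv_mem hγ') hmem
        simpa [mul_assoc] using this)
      refine Subtype.ext (MulOpposite.unop_injective ?_)
      change γ.unop = x⁻¹ * v
      rw [← this]
      simp
  -- normalization
  clear_value F
  obtain ⟨μ₀, _⟩ : ∃ μ₀ : Measure G, μ₀.IsHaarMeasure := ⟨Measure.haar, inferInstance⟩
  have hpos : μ₀ F ≠ 0 := by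
    intro h0
    have h1 : ∀ᵐ x ∂μ₀, ∀ γ : Γ, x * (γ : G) ∉ F :=
      ae_all_iff.2 fun γ => (quasiMeasurePreserving_mul_right μ₀ (γ : G)).ae
        (measure_eq_zero_iff_ae_notMem.1 h0)
    obtain ⟨x, hx⟩ := h1.exists
    obtain ⟨⟨γ, hγ⟩, hγF, -⟩ := hF x
    exact hx ⟨γ.unop, hγ⟩ hγF
  have hfin : μ₀ F ≠ ∞ := ((measure_mono subset_closure).trans_lt hFc.measure_lt_top).ne
  refine ⟨(μ₀ F)⁻¹ • μ₀, Measure.IsHaarMeasure.smul μ₀ (ENNReal.inv_ne_zero.2 hfin)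
    (ENNReal.inv_ne_top.2 hpos), ⟨⟨F, hFm, IsFundamentalDomain.mk' hFm.nullMeasurableSet hF, hFc,
      fun C hC => ?_, ?_⟩⟩⟩
  · have hcomp : IsCompact ((closure F)⁻¹ * C) := hFc.inv.mul hC
    have : IsCompact (((↑) : Γ → G) ⁻¹' ((closure F)⁻¹ * C)) :=
      hclosed.isClosedEmbedding_subtypeVal.isCompact_preimage hcomp
    refine this.finite_of_discrete.subset ?_
    rintro η ⟨_, ⟨g, hg, rfl⟩, hgC⟩
    exact ⟨g⁻¹, Set.inv_mem_inv.2 (subset_closure hg), _, hgC, by simp⟩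
  · rw [Measure.smul_apply, smul_eq_mul, ENNReal.inv_mul_cancel hpos hfin]

/-- The underlying set of the induced space `L^{[2]}(G, X)^Γ`: classes, modulo null sets, of
strongly measurable maps `f : G → X` (i.e. measurable with separable range) such that
`f (g γ⁻¹) = γ f g` and such that `g ↦ d (f g, x)` is square-integrable on the fundamental domain
for some `x`. -/
def InducedSpace {Γ : Subgroup G} {μ : Measure G} (F : RightFundamentalDomain Γ μ)
    (X : Type*) [MetricSpace X] [MulAction Γ X] : Type _ :=
  {f : G →ₘ[μ] X // (∀ γ : Γ, ∀ᵐ g ∂μ, f (g * (γ : G)⁻¹) = γ • f g) ∧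
    ∃ x : X, MemLp (fun g => dist (f g) x) 2 (μ.restrict F.carrier)}

namespace InducedSpace

variable {Γ : Subgroup G} {μ : Measure G} {F : RightFundamentalDomain Γ μ}
  {X : Type*} [MetricSpace X] [MulAction Γ X]

theorem memLp_dist_const (f : InducedSpace F X) (x : X) :
    MemLp (fun g => dist (f.1 g) x) 2 (μ.restrict F.carrier) := by
  obtain ⟨y, hy⟩ := f.2.2
  have hfin : IsFiniteMeasure (μ.restrict F.carrier) :=
    ⟨by rw [Measure.restrict_apply_univ, F.measure_eq_one]; exact ENNReal.one_lt_top⟩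
  refine (hy.add (memLp_const (dist y x))).mono
    ((f.1.aestronglyMeasurable.dist aestronglyMeasurable_const).restrict) ?_
  refine Filter.Eventually.of_forall fun g => ?_
  rw [Real.norm_of_nonneg dist_nonneg]
  exact (dist_triangle _ y _).trans (le_abs_self _)

theorem memLp_dist (f f' : InducedSpace F X) :
    MemLp (fun g => dist (f.1 g) (f'.1 g)) 2 (μ.restrict F.carrier) := by
  obtain ⟨y, hy⟩ := f.2.2
  refine (hy.add (f'.memLp_dist_const y)).mono
    ((f.1.aestronglyMeasurable.dist f'.1.aestronglyMeasurable).restrict) ?_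
  refine Filter.Eventually.of_forall fun g => ?_
  rw [Real.norm_of_nonneg dist_nonneg]
  refine (dist_triangle _ y _).trans ?_
  rw [dist_comm y]
  exact le_abs_self _

/-- The distance `(∫_F d(f(g), f'(g))² dg)^{1/2}`. -/
noncomputable instance : Dist (InducedSpace F X) where
  dist f f' := Real.sqrt (∫ g in F.carrier, dist (f.1 g) (f'.1 g) ^ 2 ∂μ)

theorem dist_def (f f' : InducedSpace F X) :
    dist f f' = Real.sqrt (∫ g in F.carrier, dist (f.1 g) (f'.1 g) ^ 2 ∂μ) := rfl

theorem dist_eq_eLpNorm (f f' : InducedSpace F X) :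
    dist f f' =
      (eLpNorm (fun g => dist (f.1 g) (f'.1 g)) 2 (μ.restrict F.carrier)).toReal := by
  rw [(memLp_dist f f').eLpNorm_eq_integral_rpow_norm two_ne_zero ENNReal.ofNat_ne_top,
    ENNReal.toReal_ofReal (by positivity), dist_def, Real.sqrt_eq_rpow]
  simp

variable [IsTopologicalGroup G] [BorelSpace G] [SecondCountableTopology G] [LocallyCompactSpace G]
  [μ.IsHaarMeasure] [DiscreteTopology Γ]

/-- Classes that agree almost everywhere on the fundamental domain agree. -/
theorem ext_of_ae_restrict (f f' : InducedSpace F X)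
    (h : ∀ᵐ g ∂μ.restrict F.carrier, f.1 g = f'.1 g) : f = f' := by
  have : Countable Γ := TopologicalSpace.separableSpace_iff_countable.1 inferInstance
  rw [ae_restrict_iff' F.measurableSet] at h
  refine Subtype.ext (AEEqFun.ext ?_)
  have h1 : ∀ᵐ g ∂μ, ∀ γ : Γ, g * (γ : G)⁻¹ ∈ F.carrier →
      f.1 (g * (γ : G)⁻¹) = f'.1 (g * (γ : G)⁻¹) :=
    ae_all_iff.2 fun γ => (quasiMeasurePreserving_mul_right μ ((γ : G)⁻¹)).ae h
  filter_upwards [F.isFundamentalDomain.ae_covers, h1, ae_all_iff.2 f.2.1, ae_all_iff.2 f'.2.1]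
    with g hg h1 h2 h3
  obtain ⟨⟨η, hη⟩, hgη⟩ := hg
  have hη' : η.unop ∈ Γ := hη
  have := h1 ⟨η.unop⁻¹, Γ.inv_mem hη'⟩ (by simpa using hgη)
  rw [h2, h3] at this
  exact smul_left_cancel _ this

noncomputable instance : MetricSpace (InducedSpace F X) where
  dist_self f := by simp [dist_def]
  dist_comm f f' := by simp [dist_def, dist_comm]
  dist_triangle f f' f'' := by
    rw [dist_eq_eLpNorm, dist_eq_eLpNorm, dist_eq_eLpNorm, ← ENNReal.toReal_add
      (memLp_dist f f').eLpNorm_ne_top (memLp_dist f' f'').eLpNorm_ne_top]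
    refine ENNReal.toReal_mono (ENNReal.add_ne_top.2
      ⟨(memLp_dist f f').eLpNorm_ne_top, (memLp_dist f' f'').eLpNorm_ne_top⟩) ?_
    refine le_trans (eLpNorm_mono_real fun g => ?_) (eLpNorm_add_le
      (memLp_dist f f').1 (memLp_dist f' f'').1 one_le_two)
    rw [Real.norm_of_nonneg dist_nonneg]
    exact dist_triangle _ _ _
  eq_of_dist_eq_zero {f f'} h := by
    refine ext_of_ae_restrict f f' ?_
    rw [dist_eq_eLpNorm, ENNReal.toReal_eq_zero_iff,
      or_iff_left (memLp_dist f f').eLpNorm_ne_top,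
      eLpNorm_eq_zero_iff (memLp_dist f f').1 two_ne_zero] at h
    filter_upwards [h] with g hg
    exact dist_eq_zero.1 hg

/-- Left translation of function classes: `(h f) g = f (h⁻¹ g)`. -/
noncomputable def translate (h : G) (f : G →ₘ[μ] X) : G →ₘ[μ] X :=
  f.compMeasurePreserving (fun g => h⁻¹ * g) (measurePreserving_mul_left μ h⁻¹)


variable [IsIsometricSMul Γ X]

theorem translate_mem (h : G) (f : InducedSpace F X) :
    (∀ γ : Γ, ∀ᵐ g ∂μ, translate h f.1 (g * (γ : G)⁻¹) = γ • translate h f.1 g) ∧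
      ∃ x : X, MemLp (fun g => dist (translate h f.1 g) x) 2 (μ.restrict F.carrier) := by
  have hae : ∀ᵐ g ∂μ, translate h f.1 g = f.1 (h⁻¹ * g) :=
    AEEqFun.coeFn_compMeasurePreserving _ _
  constructor
  · intro γ
    filter_upwards [hae, (quasiMeasurePreserving_mul_right μ ((γ : G)⁻¹)).ae hae,
      (measurePreserving_mul_left μ h⁻¹).quasiMeasurePreserving.ae (f.2.1 γ)] with g h1 h2 h3
    rw [h1, h2, ← h3, mul_assoc]
  · obtain ⟨x, -⟩ := f.2.2
    refine ⟨x, ((translate h f.1).aestronglyMeasurable.dist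
      aestronglyMeasurable_const).restrict, ?_⟩
    -- a finite set of translates covers `h⁻¹ F`
    have hC : IsCompact ((fun g => h⁻¹ * g) '' closure F.carrier) :=
      F.isCompact_closure.image (continuous_const_mul _)
    have hfin := F.finite_meet _ hC
    set A : Finset Γ := hfin.toFinset with hA
    have hcov : ∀ᵐ g ∂μ, h * g ∈ F.carrier → ∃ η ∈ A, g * (η : G)⁻¹ ∈ F.carrier := by
      filter_upwards [F.isFundamentalDomain.ae_covers] with g hg hhg
      obtain ⟨⟨η, hη⟩, hgη⟩ := hg
      have hη' : η.unop ∈ Γ := hη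
      have hgη' : g * η.unop ∈ F.carrier := hgη
      refine ⟨⟨η.unop⁻¹, Γ.inv_mem hη'⟩, ?_, by simpa using hgη'⟩
      simp only [hA, Set.Finite.mem_toFinset, Set.mem_ofPred_eq]
      exact ⟨g, ⟨_, hgη', by simp⟩, ⟨_, subset_closure hhg, by simp⟩⟩
    -- each translate carries a finite integral
    have hfinite : ∀ η : Γ, ∫⁻ g, F.carrier.indicator
        (fun k => ‖dist (f.1 k) (η • x)‖ₑ ^ (2 : ℝ)) (g * (η : G)⁻¹) ∂μ < ∞ := by
      intro η
      have h1 := (f.memLp_dist_const (η • x))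
      have h2 := lintegral_rpow_enorm_lt_top_of_eLpNorm_lt_top two_ne_zero
        ENNReal.ofNat_ne_top h1.2
      rw [ENNReal.toReal_ofNat] at h2
      have hmeas : AEMeasurable (F.carrier.indicator
          (fun k => ‖dist (f.1 k) (η • x)‖ₑ ^ (2 : ℝ))) μ :=
        ((f.1.aestronglyMeasurable.dist aestronglyMeasurable_const).enorm.pow_const _).indicator
          F.measurableSet
      have hmap := Measure.isMulLeftInvariant_eq_smul (Measure.map (· * (η : G)⁻¹) μ) μ
      rw [← lintegral_map' (f := F.carrier.indicator
          (fun k => ‖dist (f.1 k) (η • x)‖ₑ ^ (2 : ℝ))) (g := fun g => g * (η : G)⁻¹)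
        (hmeas.mono_ac (quasiMeasurePreserving_mul_right μ ((η : G)⁻¹)).absolutelyContinuous)
        (measurable_mul_const _).aemeasurable, hmap, lintegral_smul_measure,
        lintegral_indicator F.measurableSet]
      exact ENNReal.mul_lt_top ENNReal.coe_lt_top h2
    rw [eLpNorm_lt_top_iff_lintegral_rpow_enorm_lt_top two_ne_zero ENNReal.ofNat_ne_top,
      ENNReal.toReal_ofNat, ← lintegral_indicator F.measurableSet,
      ← lintegral_mul_left_eq_self _ h]
    refine lt_of_le_of_lt (lintegral_mono_ae (g := fun g => ∑ η ∈ A, F.carrier.indicator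
        (fun k => ‖dist (f.1 k) (η • x)‖ₑ ^ (2 : ℝ)) (g * (η : G)⁻¹)) ?_) ?_
    · have : Countable Γ := TopologicalSpace.separableSpace_iff_countable.1 inferInstance
      filter_upwards [hcov, (measurePreserving_mul_left μ h).quasiMeasurePreserving.ae hae,
        ae_all_iff.2 f.2.1] with g hg h1 h2
      by_cases hgF : h * g ∈ F.carrier
      · obtain ⟨η, hηA, hη⟩ := hg hgF
        refine le_trans (le_of_eq ?_) (Finset.single_le_sum (fun _ _ => zero_le) hηA)
        rw [indicator_of_mem hgF, indicator_of_mem hη, h1, h2, dist_smul, inv_mul_cancel_left]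
      · rw [indicator_of_notMem hgF]
        exact zero_le
    · rw [lintegral_finsetSum']
      · exact ENNReal.sum_lt_top.2 fun η _ => hfinite η
      · intro η _
        exact (((f.1.aestronglyMeasurable.dist
          aestronglyMeasurable_const).enorm.pow_const _).indicator
          F.measurableSet).comp_quasiMeasurePreserving
            (quasiMeasurePreserving_mul_right μ ((η : G)⁻¹))

/-- The induced `G`-action `(h f) g = f (h⁻¹ g)` on `L^{[2]}(G, X)^Γ`. -/
noncomputable instance : MulAction G (InducedSpace F X) where
  smul h f := ⟨translate h f.1, translate_mem h f⟩
  one_smul f := by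
    refine Subtype.ext ?_
    change translate 1 f.1 = f.1
    refine AEEqFun.ext ?_
    filter_upwards [AEEqFun.coeFn_compMeasurePreserving f.1
      (measurePreserving_mul_left μ (1 : G)⁻¹)] with g hg
    rw [translate, hg]
    simp
  mul_smul h k f := by
    refine Subtype.ext ?_
    change translate (h * k) f.1 = translate h (translate k f.1)
    refine AEEqFun.ext ?_
    filter_upwards [AEEqFun.coeFn_compMeasurePreserving f.1
      (measurePreserving_mul_left μ (h * k)⁻¹),
      AEEqFun.coeFn_compMeasurePreserving (translate k f.1) (measurePreserving_mul_left μ h⁻¹),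
      (measurePreserving_mul_left μ h⁻¹).quasiMeasurePreserving.ae
        (AEEqFun.coeFn_compMeasurePreserving f.1 (measurePreserving_mul_left μ k⁻¹))]
      with g h1 h2 h3
    rw [translate, h1, translate, h2]
    simp only [Function.comp_apply] at h3 ⊢
    rw [translate, h3]
    simp [mul_assoc]

end InducedSpace

end Induction

/-! Each `f ∈ T` is replaced by one of its own values, chosen so that it nearly represents `f` and
is moved a controlled amount by every `γ`. By equivariance, `d(γ f(u), f(g)) = d(f(uγ⁻¹), f(g))` for
almost every `u`. Substituting `u = hgγ` turns this into `d(f(hg), f(g))`, and for `u`, `g` in the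
relatively compact domain `F` the variable `h` stays in a compact set depending only on `γ`.
Integrating over `g` first gives the squared displacement of `f` by `h⁻¹`, which evanescence bounds
uniformly over `T`. So the mean of `d²(γ f(u), f(g))` over `F × F` is at most some `C γ`,
independent of `f`. As `Γ` is countable, a weighted sum over `γ` yields a single `g` for which all
the means over `u` are at most `M γ`, again independent of `f`. Put `p f = f(g)`. Comparing `γ p(f)`
with `p(f)` through `γ f(u)` bounds the displacement by `M 1` and `M γ`. The case `γ = 1` keeps `f`
within bounded distance of the constant `p f`, so `p '' T` is unbounded because `T` is. -/

/-! ### Haar measure and averaging estimates -/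

/-- Right translations by elements of a compact set distort a left Haar measure by a bounded
factor. -/
theorem exists_lintegral_le_mul_lintegral_mul_right {G : Type*} [Group G] [TopologicalSpace G]
    [IsTopologicalGroup G] [T2Space G] [LocallyCompactSpace G] [SecondCountableTopology G]
    [MeasurableSpace G] [BorelSpace G] (μ : Measure G) [μ.IsHaarMeasure] {K : Set G}
    (hK : IsCompact K) :
    ∃ c : ℝ≥0∞, c ≠ ∞ ∧ ∀ k ∈ K, ∀ φ : G → ℝ≥0∞, Measurable φ →
      ∫⁻ u, φ u ∂μ ≤ c * ∫⁻ h, φ (h * k) ∂μ := by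
  obtain ⟨A, hA, hA1⟩ := exists_compact_mem_nhds (1 : G)
  have hA0 : μ A ≠ 0 := (μ.measure_pos_of_mem_nhds hA1).ne'
  have hAt : μ A ≠ ∞ := hA.measure_lt_top.ne
  have hAK : IsCompact (A * K) := hA.mul hK
  -- Right translation by `k` scales `μ` by a factor `a`. Since `A * k ⊆ A * K`, `a * μ (A * K) ≥ μ
  -- A`, which bounds `a` below uniformly in `k ∈ K`.
  refine ⟨μ (A * K) / μ A, ENNReal.div_ne_top hAK.measure_lt_top.ne hA0, fun k hk φ hφ => ?_⟩
  have hmap := Measure.isMulLeftInvariant_eq_smul (Measure.map (· * k) μ) μ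
  set a := Measure.haarScalarFactor (Measure.map (· * k) μ) μ
  have ha : μ A ≤ a * μ (A * K) := by
    have h1 : Measure.map (· * k) μ (A * K) = a * μ (A * K) := by rw [hmap]; rfl
    rw [← h1, Measure.map_apply (measurable_mul_const k) hAK.measurableSet]
    exact measure_mono fun x hx => mul_mem_mul hx hk
  have hint : ∫⁻ h, φ (h * k) ∂μ = a * ∫⁻ u, φ u ∂μ := by
    rw [← lintegral_map hφ (measurable_mul_const k), hmap, lintegral_smul_measure]
    rfl
  rw [hint, ← mul_assoc]
  refine le_mul_of_one_le_left zero_le ?_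
  rw [div_eq_mul_inv, mul_right_comm, ← div_eq_mul_inv, ENNReal.le_div_iff_mul_le (.inl hA0)
    (.inl hAt), one_mul, mul_comm]
  exact ha

/-- Countably many nonnegative functions with prescribed bounds on their means are simultaneously
bounded at some point, by constants depending only on the bounds on the means. -/
theorem exists_forall_le_of_lintegral_le {α ι : Type*} [MeasurableSpace α] (μ : Measure α)
    [IsProbabilityMeasure μ] [Countable ι] (C : ι → ℝ≥0∞) (hC : ∀ i, C i ≠ ∞) :
    ∃ M : ι → ℝ≥0∞, (∀ i, M i ≠ ∞) ∧ ∀ a : ι → α → ℝ≥0∞, (∀ i, Measurable (a i)) →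
      (∀ i, ∫⁻ x, a i x ∂μ ≤ C i) → ∃ x, ∀ i, a i x ≤ M i := by
  -- The weights satisfy `∑ C i * δ i < 1` and depend on `C` alone. The weighted sum of the
  -- functions has mean at most `1`, so at some point every `a i x * δ i` is at most `1`.
  obtain ⟨δ, hδ, hsum⟩ := ENNReal.exists_pos_tsum_mul_lt_of_countable one_ne_zero C hC
  refine ⟨fun i => 1 / δ i, fun i => ENNReal.div_ne_top ENNReal.one_ne_top
    (ENNReal.coe_pos.2 (hδ i)).ne', fun a ha haC => ?_⟩
  have hm : ∀ i, Measurable fun x => a i x * δ i := fun i => (ha i).mul_const _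
  obtain ⟨x, hx⟩ := exists_le_lintegral (μ := μ) (f := fun x => ∑' i, a i x * δ i)
    (Measurable.tsum hm).aemeasurable
  refine ⟨x, fun i => ?_⟩
  rw [ENNReal.le_div_iff_mul_le (.inl (ENNReal.coe_pos.2 (hδ i)).ne') (.inl ENNReal.coe_ne_top)]
  calc a i x * δ i ≤ ∑' i, a i x * δ i := ENNReal.le_tsum (f := fun i => a i x * δ i) i
    _ ≤ ∫⁻ x, ∑' i, a i x * δ i ∂μ := hx
    _ = ∑' i, (∫⁻ x, a i x ∂μ) * δ i := by
      rw [lintegral_tsum fun i => (hm i).aemeasurable]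
      exact tsum_congr fun i => lintegral_mul_const _ (ha i)
    _ ≤ ∑' i, C i * δ i := ENNReal.tsum_le_tsum fun i => mul_le_mul_left (haC i) _
    _ ≤ 1 := hsum.le

theorem edist_sq_le_two_mul_add {X : Type*} [PseudoEMetricSpace X] (x y z : X) :
    edist x z ^ 2 ≤ 2 * (edist x y ^ 2 + edist y z ^ 2) := by
  refine (pow_le_pow_left₀ zero_le (edist_triangle x y z) 2).trans ?_
  have := ENNReal.rpow_add_le_mul_rpow_add_rpow (edist x y) (edist y z) (p := 2) one_le_two
  norm_num at this
  exact_mod_cast this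

theorem dist_le_sqrt_of_edist_sq_le {X : Type*} [PseudoMetricSpace X] {x y : X} {c : ℝ≥0∞}
    (hc : c ≠ ∞) (h : edist x y ^ 2 ≤ c) : dist x y ≤ √c.toReal := by
  refine Real.le_sqrt_of_sq_le ?_
  have := ENNReal.toReal_mono hc h
  rwa [ENNReal.toReal_pow, ← dist_edist] at this

/-! ### Mean square displacements in the induced space -/

namespace InducedSpace

variable {G : Type*} [Group G] [TopologicalSpace G] [MeasurableSpace G]
  {Γ : Subgroup G} {μ : Measure G} {F : RightFundamentalDomain Γ μ}
  {X : Type*} [MetricSpace X] [MulAction Γ X]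

theorem measurable_edist_sq (f : InducedSpace F X) {α : Type*} [MeasurableSpace α] {p q : α → G}
    (hp : Measurable p) (hq : Measurable q) :
    Measurable fun a => edist (f.1 (p a)) (f.1 (q a)) ^ 2 := by
  have hf := f.1.stronglyMeasurable
  exact ((hf.comp_measurable hp).edist (hf.comp_measurable hq)).measurable.pow_const 2

variable [IsTopologicalGroup G] [BorelSpace G] [SecondCountableTopology G] [LocallyCompactSpace G]
  [μ.IsHaarMeasure] [DiscreteTopology Γ]

theorem lintegral_edist_sq (f f' : InducedSpace F X) :
    ∫⁻ g in F.carrier, edist (f.1 g) (f'.1 g) ^ 2 ∂μ = edist f f' ^ 2 := by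
  have h0 : 0 ≤ ∫ g in F.carrier, dist (f.1 g) (f'.1 g) ^ 2 ∂μ := integral_nonneg fun _ => by
    positivity
  rw [edist_dist, ← ENNReal.ofReal_pow dist_nonneg, dist_def, Real.sq_sqrt h0,
    ofReal_integral_eq_lintegral_ofReal (memLp_dist f f').integrable_sq
      (Filter.Eventually.of_forall fun _ => by positivity)]
  simp only [edist_dist, ENNReal.ofReal_pow dist_nonneg]

variable [IsIsometricSMul Γ X]

/-- The inverse appears because `(h⁻¹ f)(g) = f(hg)`. -/
theorem lintegral_edist_sq_mul_left (f : InducedSpace F X) (h : G) :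
    ∫⁻ g in F.carrier, edist (f.1 (h * g)) (f.1 g) ^ 2 ∂μ = edist (h⁻¹ • f) f ^ 2 := by
  rw [← lintegral_edist_sq]
  refine lintegral_congr_ae (ae_restrict_of_ae ?_)
  filter_upwards [AEEqFun.coeFn_compMeasurePreserving f.1
    (measurePreserving_mul_left μ (h⁻¹)⁻¹)] with g hg
  change _ = edist (translate h⁻¹ f.1 g) _ ^ 2
  rw [translate, hg]
  simp

/-- The values of maps in an evanescent set, twisted by `γ`, have bounded mean square distance. -/
theorem exists_lintegral_lintegral_edist_sq_smul_le [T2Space G] {T : Set (InducedSpace F X)}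
    (hT : ∀ Q : Set G, IsCompact Q → IsEvanescentSet Q T) (γ : Γ) :
    ∃ C : ℝ≥0∞, C ≠ ∞ ∧ ∀ f ∈ T, ∫⁻ g in F.carrier, ∫⁻ u in F.carrier,
      edist (γ • f.1 u) (f.1 g) ^ 2 ∂μ ∂μ ≤ C := by
  set B := closure F.carrier
  have hB : IsCompact B := F.isCompact_closure
  obtain ⟨c, hc, hcle⟩ := exists_lintegral_le_mul_lintegral_mul_right μ
    (hB.mul (isCompact_singleton (x := (γ : G))))
  -- This compact set contains every `h` with `h * (g * γ) ∈ F` for some `g ∈ F`.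
  have hQ : IsCompact (B * (B * {(γ : G)})⁻¹) := hB.mul (hB.mul isCompact_singleton).inv
  set Q := B * (B * {(γ : G)})⁻¹
  obtain ⟨K, hK⟩ := hT Q⁻¹ hQ.inv
  refine ⟨c * (ENNReal.ofReal K ^ 2 * μ Q), ENNReal.mul_ne_top hc (ENNReal.mul_ne_top
    (by simp) hQ.measure_lt_top.ne), fun f hf => ?_⟩
  have hmeas : Measurable fun p : G × G => edist (f.1 (p.2 * p.1)) (f.1 p.1) ^ 2 :=
    f.measurable_edist_sq (measurable_snd.mul measurable_fst) measurable_fst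
  calc ∫⁻ g in F.carrier, ∫⁻ u in F.carrier, edist (γ • f.1 u) (f.1 g) ^ 2 ∂μ ∂μ
      ≤ ∫⁻ g in F.carrier, c * ∫⁻ h in Q, edist (f.1 (h * g)) (f.1 g) ^ 2 ∂μ ∂μ := by
        refine setLIntegral_mono' F.measurableSet fun g hg => ?_
        have hm : Measurable fun u => edist (f.1 (u * (γ : G)⁻¹)) (f.1 g) ^ 2 :=
          f.measurable_edist_sq (measurable_mul_const _) measurable_const
        have hgγ : g * (γ : G) ∈ B * {(γ : G)} := mul_mem_mul (subset_closure hg) rfl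
        calc ∫⁻ u in F.carrier, edist (γ • f.1 u) (f.1 g) ^ 2 ∂μ
            = ∫⁻ u in F.carrier, edist (f.1 (u * (γ : G)⁻¹)) (f.1 g) ^ 2 ∂μ := by
              refine lintegral_congr_ae (ae_restrict_of_ae ?_)
              filter_upwards [f.2.1 γ] with u hu
              rw [hu]
          _ = ∫⁻ u, F.carrier.indicator
                (fun u => edist (f.1 (u * (γ : G)⁻¹)) (f.1 g) ^ 2) u ∂μ :=
              (lintegral_indicator F.measurableSet _).symm
          _ ≤ _ := hcle _ hgγ _ (hm.indicator F.measurableSet)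
          -- After the substitution `u = h g γ`, the indicator of `F` vanishes unless `h ∈ Q`, and
          -- `u γ⁻¹ = h g`.
          _ ≤ c * ∫⁻ h in Q, edist (f.1 (h * g)) (f.1 g) ^ 2 ∂μ := by
              rw [← lintegral_indicator hQ.measurableSet]
              gcongr with h
              by_cases hh : h * (g * γ) ∈ F.carrier
              · have hhQ : h ∈ Q := ⟨h * (g * γ), subset_closure hh, (g * γ)⁻¹,
                  Set.inv_mem_inv.2 hgγ, mul_inv_cancel_right _ _⟩
                rw [indicator_of_mem hh, indicator_of_mem hhQ]
                simp [mul_assoc]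
              · rw [indicator_of_notMem hh]
                exact zero_le
    _ = c * ∫⁻ h in Q, ∫⁻ g in F.carrier, edist (f.1 (h * g)) (f.1 g) ^ 2 ∂μ ∂μ := by
        rw [lintegral_const_mul _ hmeas.lintegral_prod_right',
          lintegral_lintegral_swap (f := fun g h => edist (f.1 (h * g)) (f.1 g) ^ 2)
            hmeas.aemeasurable]
    _ ≤ c * ∫⁻ h in Q, ENNReal.ofReal K ^ 2 ∂μ := by
        refine mul_le_mul_right ?_ c
        refine setLIntegral_mono' hQ.measurableSet fun h hh => ?_
        rw [lintegral_edist_sq_mul_left, edist_dist]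
        gcongr
        exact hK _ (Set.inv_mem_inv.2 hh) f hf
    _ = c * (ENNReal.ofReal K ^ 2 * μ Q) := by rw [setLIntegral_const]

end InducedSpace

/-! ### Transfer of evanescence from `G` to `Γ` -/

theorem mainTheorem7 {G : Type*} [Group G] [TopologicalSpace G] [IsTopologicalGroup G]
    [T2Space G] [LocallyCompactSpace G] [SecondCountableTopology G]
    [MeasurableSpace G] [BorelSpace G]
    (Γ : Subgroup G) [DiscreteTopology Γ] [CompactSpace (G ⧸ Γ)]
    (μ : MeasureTheory.Measure G) [μ.IsHaarMeasure] (F : RightFundamentalDomain Γ μ)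
    {X : Type*} [MetricSpace X] [CompleteSpace X] [TopologicalSpace.SeparableSpace X] [IsCAT0 X]
    [MulAction Γ X] [IsIsometricSMul Γ X]
    (h : IsEvanescent G (InducedSpace F X)) :
    IsEvanescent Γ X := by
  have : Countable Γ := TopologicalSpace.separableSpace_iff_countable.1 inferInstance
  have hprob : IsProbabilityMeasure (μ.restrict F.carrier) :=
    ⟨by rw [Measure.restrict_apply_univ, F.measure_eq_one]⟩
  obtain ⟨T, hTunb, hT⟩ := h
  choose C hC hCle using InducedSpace.exists_lintegral_lintegral_edist_sq_smul_le hT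
  -- `M` is fixed before `f`: the selected point of `F` may vary with `f`, the bounds may not.
  obtain ⟨M, hM, hMle⟩ := exists_forall_le_of_lintegral_le (μ.restrict F.carrier) C hC
  -- every `f ∈ T` has a value at bounded mean square distance from each `γ • f`
  have hsel : ∀ f ∈ T, ∃ x : X, ∀ γ : Γ,
      ∫⁻ u in F.carrier, edist (γ • f.1 u) x ^ 2 ∂μ ≤ M γ := by
    intro f hf
    obtain ⟨g, hg⟩ := hMle
      (fun γ g => ∫⁻ u in F.carrier, edist (γ • f.1 u) (f.1 g) ^ 2 ∂μ) (fun γ => by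
        have hs := f.1.stronglyMeasurable
        have : Measurable fun p : G × G => edist (γ • f.1 p.2) (f.1 p.1) ^ 2 :=
          ((((isometry_smul X γ).continuous.comp_stronglyMeasurable hs).comp_measurable
            measurable_snd).edist (hs.comp_measurable measurable_fst)).measurable.pow_const 2
        exact this.lintegral_prod_right') (fun γ => hCle γ f hf)
    exact ⟨f.1 g, hg⟩
  obtain ⟨f₀, hf₀⟩ : T.Nonempty := nonempty_iff_ne_empty.2 fun hT0 =>
    hTunb (hT0 ▸ Bornology.isBounded_empty)
  have : Nonempty X := (hsel f₀ hf₀).nonempty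
  choose! p hp using hsel
  have hmeas : ∀ (f : InducedSpace F X) (x : X), Measurable fun u => edist (f.1 u) x ^ 2 :=
    fun f x => (f.1.stronglyMeasurable.edist stronglyMeasurable_const).measurable.pow_const 2
  have hp1 : ∀ f ∈ T, ∫⁻ u in F.carrier, edist (f.1 u) (p f) ^ 2 ∂μ ≤ M 1 := fun f hf => by
    simpa using hp f hf 1
  refine ⟨p '' T, fun hbdd => hTunb ?_, fun Q hQ => ?_⟩
  -- A bound on `p '' T` would bound `T`, through the chain `f(u)`, `p f`, `p f₀`, `f₀(u)`.
  · obtain ⟨R, hR⟩ := (Metric.isBounded_iff_subset_closedBall (p f₀)).1 hbdd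
    refine (Metric.isBounded_iff_subset_closedBall f₀).2
      ⟨√(2 * (M 1 + 2 * (ENNReal.ofReal R ^ 2 + M 1))).toReal, fun f hf => ?_⟩
    refine dist_le_sqrt_of_edist_sq_le (by finiteness [hM 1]) ?_
    rw [← InducedSpace.lintegral_edist_sq]
    calc ∫⁻ u in F.carrier, edist (f.1 u) (f₀.1 u) ^ 2 ∂μ
        ≤ ∫⁻ u in F.carrier, 2 * (edist (f.1 u) (p f) ^ 2 +
            2 * (ENNReal.ofReal R ^ 2 + edist (f₀.1 u) (p f₀) ^ 2)) ∂μ := by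
          refine lintegral_mono fun u => (edist_sq_le_two_mul_add _ (p f) _).trans ?_
          gcongr
          refine (edist_sq_le_two_mul_add _ (p f₀) _).trans ?_
          rw [edist_comm (p f₀), edist_dist (p f)]
          gcongr
          exact hR ⟨f, hf, rfl⟩
      _ = 2 * (∫⁻ u in F.carrier, edist (f.1 u) (p f) ^ 2 ∂μ +
            2 * (ENNReal.ofReal R ^ 2 +
              ∫⁻ u in F.carrier, edist (f₀.1 u) (p f₀) ^ 2 ∂μ)) := by
          rw [lintegral_const_mul' _ _ (by simp), lintegral_add_left (hmeas f _),
            lintegral_const_mul' _ _ (by simp), lintegral_add_left measurable_const,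
            lintegral_const, measure_univ, mul_one]
      _ ≤ _ := by
          gcongr
          · exact hp1 f hf
          · exact hp1 f₀ hf₀
  · have hdisp : ∀ γ : Γ, ∀ f ∈ T, dist (γ • p f) (p f) ≤ √(2 * (M 1 + M γ)).toReal := by
      intro γ f hf
      refine dist_le_sqrt_of_edist_sq_le (by finiteness [hM 1, hM γ]) ?_
      calc edist (γ • p f) (p f) ^ 2
          = ∫⁻ _ in F.carrier, edist (γ • p f) (p f) ^ 2 ∂μ := by
            rw [lintegral_const, measure_univ, mul_one]
        _ ≤ ∫⁻ u in F.carrier,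
              2 * (edist (f.1 u) (p f) ^ 2 + edist (γ • f.1 u) (p f) ^ 2) ∂μ := by
            refine lintegral_mono fun u => (edist_sq_le_two_mul_add _ (γ • f.1 u) _).trans ?_
            rw [edist_smul_left, edist_comm (p f)]
        _ = 2 * (∫⁻ u in F.carrier, edist (f.1 u) (p f) ^ 2 ∂μ +
              ∫⁻ u in F.carrier, edist (γ • f.1 u) (p f) ^ 2 ∂μ) := by
            rw [lintegral_const_mul' _ _ (by simp), lintegral_add_left (hmeas f _)]
        _ ≤ _ := by
            gcongr
            · exact hp1 f hf
            · exact hp f hf γ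
    -- Compact subsets of the discrete group `Γ` are finite, so the bounds for single elements
    -- suffice.
    obtain ⟨K, hK⟩ := (hQ.finite_of_discrete.image
      fun γ : Γ => √(2 * (M 1 + M γ)).toReal).bddAbove
    refine ⟨K, ?_⟩
    rintro γ hγ _ ⟨f, hf, rfl⟩
    exact (hdisp γ f hf).trans (hK ⟨γ, hγ, rfl⟩)
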